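/- Let $n\ge 1$ and let $H:\{+1,-1\}^n\to\mathbb{R}$ be a cost function with $\sum_z H(z)=0$. Put $E^*=\min_z H(z)$ and $C(E)=|\{z : H(z)\le E\}|$. For $0<\eta<1$ and $x\ge -1$ let $g_\eta(x)=\min\bigl(0,(x+1-\eta)/\eta\bigr)$, and let $g_0$ be the pointwise limit as $\eta\downarrow 0$, i.e. $g_0(-1)=-1$ and $g_0(x)=0$ for $x>-1$. For $b\ge 0$ let $H_b$ be the $n$-qubit Hamiltonian $$H_b=-\frac{1}{n}\sum_{i=1}^n X_i+b\,g_\eta\!\left(\frac{H}{|E^*|}\right),$$ where $X_i$ is the Pauli-$X$ operator on qubit $i$ and $g_\eta(H/|E^*|)$ is the operator that is diagonal in the computational basis $\{|z\rangle\}$ with entries $g_\eta(H(z)/|E^*|)$. Let $E_b$ be the smallest eigenvalue (ground-state energy) of $H_b$. Let $0\le\eta<1$ and suppose that $$C\bigl((1-\eta)E^*\bigr)\le 2^{(1-\gamma)n}$$ for some real number $\gamma\ge (1+4\log_2 n)/n$. (These assumptions force $E^*<0$.) Then for every $b$ with $$0\le b\le \frac{\ln(2)\,\gamma}{2+\ln(2)},$$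 both of the following hold: 1. (large-excited-energy condition) the eigenvalue $E_b$ of $H_b$ is non-degenerate, and every other eigenvalue of $H_b$ is greater than $-1+1/n$; 2. (small-ground-energy-shift condition) $-1-1/n^3\le E_b\le -1$. -/

import Mathlib

noncomputable section

namespace ShortPath

/-- The assignments `{+1,-1}ⁿ`; they also label the computational basis of `n` qubits. -/
abbrev Assignment (n : ℕ) : Type := Fin n → ℤˣ

/-- The assignment `z` with its `i`th bit negated. -/
def flip {n : ℕ} (i : Fin n) (z : Assignment n) : Assignment n :=
  Function.update z i (-z i)

/-- An operator on `n` qubits, as a matrix in the computational basis. -/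
abbrev Operator (n : ℕ) : Type := Matrix (Assignment n) (Assignment n) ℂ

/-- The Pauli-`X` operator on qubit `i`: it sends `|w⟩` to `|flip i w⟩`. -/
def pauliX {n : ℕ} (i : Fin n) : Operator n :=
  Matrix.of fun z w => if z = flip i w then 1 else 0

/-- The transverse field `X = ∑ i, X_i`. -/
def transverseField (n : ℕ) : Operator n := ∑ i, pauliX i

/-- The optimal value `E* = min_z H(z)`. -/
def optimalCost {n : ℕ} (H : Assignment n → ℝ) : ℝ :=
  Finset.univ.inf' Finset.univ_nonempty H

/-- `C(E)`, the number of assignments with cost at most `E`. -/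
def cumulativeCount {n : ℕ} (H : Assignment n → ℝ) (E : ℝ) : ℕ :=
  {z | H z ≤ E}.ncard

/-- The function `g_η(x) = min(0, (x + 1 - η)/η)` on `[-1, ∞)`. For `η = 0` it is the pointwise
limit as `η` decreases to `0`: the value is `-1` at `x = -1` and `0` for `x > -1`. -/
def g (η x : ℝ) : ℝ :=
  if η = 0 then (if x ≤ -1 then -1 else 0) else min 0 ((x + 1 - η) / η)

/-- The Hamiltonian `H_b = -X/n + b g_η(H/|E*|)`. -/
def hamiltonian {n : ℕ} (H : Assignment n → ℝ) (η b : ℝ) : Operator n :=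
  -((1 / (n : ℂ)) • transverseField n) +
    (b : ℂ) • Matrix.diagonal fun z => ((g η (H z / |optimalCost H|) : ℝ) : ℂ)

/-- The energies of a Hamiltonian: its (real) eigenvalues. -/
def energies {n : ℕ} (K : Operator n) : Set ℝ :=
  {E | Module.End.HasEigenvalue (Matrix.toLin' K) (E : ℂ)}

/-- The ground-state energy: the least eigenvalue (the set of eigenvalues of a Hermitian matrix is
finite and non-empty). -/
def groundEnergy {n : ℕ} (K : Operator n) : ℝ := sInf (energies K)

/-- The ground space: the eigenspace of the ground-state energy. -/
def groundSpace {n : ℕ} (K : Operator n) : Submodule ℂ (Assignment n → ℂ) :=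
  Module.End.eigenspace (Matrix.toLin' K) (groundEnergy K : ℂ)

/-- The large-excited-energy condition: the ground state is non-degenerate, and every excited
state has energy greater than `-1 + 1/n`. -/
def LargeExcitedEnergy {n : ℕ} (K : Operator n) : Prop :=
  Module.finrank ℂ (groundSpace K) = 1 ∧
    ∀ E ∈ energies K, E ≠ groundEnergy K → -1 + 1 / (n : ℝ) < E

/-- The small-ground-energy-shift condition: `-1 - 1/n³ ≤ E_b ≤ -1`. -/
def SmallGroundEnergyShift {n : ℕ} (K : Operator n) : Prop :=
  -1 - 1 / (n : ℝ) ^ 3 ≤ groundEnergy K ∧ groundEnergy K ≤ -1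

end ShortPath

end

namespace ShortPath

open Finset

/-! ### The two-point inequality -/

/-! Up to the factor `n`, the quadratic form of `H_b` is the hypercube Dirichlet form minus `n‖u‖²`
plus the potential `nb∑u²g` (`energyForm_eq`). Since `g` is nonpositive, the potential must be kept
from lowering the energy too far. The dual logarithmic Sobolev inequality (`log_sobolev`) bounds
`∑u²F` by the Dirichlet form plus `‖u‖²` times the log of the mean of `exp F`. With `F` a negative
multiple of `g`, that mean is controlled by the tail count, because `-1 ≤ g ≤ 0` and `g` vanishes
above the threshold (`sum_exp_le`).

Taking `F = -nb·g` spends the whole Dirichlet form and gives the lower bound on every energy. On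
vectors orthogonal to the uniform superposition, taking `F` larger by the factor `2 + ln 2` spends
only part of it; the Poincaré inequality (spectral gap 2) turns the rest into a strict bound above
`-1 + 1/n`. A form exceeding `c` on a hyperplane leaves room for at most one eigenvalue `≤ c`,
counted with multiplicity. The uniform superposition, as a trial state, shows that there is one at
most `-1`. -/

theorem log_one_sub_sq_le_mul_log {r : ℝ} (h0 : 0 ≤ r) (h1 : r < 1) :
    Real.log (1 + r) + Real.log (1 - r) ≤ Real.log (1 + r) * Real.log (1 - r) := by
  -- Two monotonicity arguments from `0`: the difference of the two sides has derivative `N(x)/(1 -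
  -- x²)`, where `N(0) = 0` and `N'(x) = -log(1 - x²) ≥ 0`.
  have hN : MonotoneOn (fun x : ℝ => (1 - x) * Real.log (1 - x) - (1 + x) * Real.log (1 + x) + 2 * x)
      (Set.Ico 0 1) := by
    have hd : ∀ x ∈ Set.Ico (0 : ℝ) 1, HasDerivAt
        (fun x : ℝ => (1 - x) * Real.log (1 - x) - (1 + x) * Real.log (1 + x) + 2 * x)
        (-(Real.log (1 - x) + Real.log (1 + x))) x := by
      intro x hx
      have h1 : (1 - x) ≠ 0 := by linarith [hx.2]
      have h2 : (1 + x) ≠ 0 := by linarith [hx.1]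
      have e1 : HasDerivAt (fun x : ℝ => 1 - x) (-1) x := by
        simpa using (hasDerivAt_id x).const_sub 1
      have e2 : HasDerivAt (fun x : ℝ => 1 + x) 1 x := by
        simpa using (hasDerivAt_id x).const_add 1
      refine (((e1.mul (e1.log h1)).sub (e2.mul (e2.log h2))).add
        ((hasDerivAt_id x).const_mul 2)).congr_deriv ?_
      field_simp
      ring
    refine monotoneOn_of_deriv_nonneg (convex_Ico 0 1)
      (fun x hx => (hd x hx).continuousAt.continuousWithinAt)
      (fun x hx => (hd x (interior_subset hx)).differentiableAt.differentiableWithinAt) ?_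
    intro x hx
    have hx' := interior_subset hx
    rw [(hd x hx').deriv, ← Real.log_mul (by linarith [hx'.2]) (by linarith [hx'.1])]
    have : Real.log ((1 - x) * (1 + x)) ≤ 0 :=
      Real.log_nonpos (by nlinarith [hx'.1, hx'.2]) (by nlinarith [hx'.1])
    linarith
  have hφ : MonotoneOn (fun x : ℝ => Real.log (1 + x) * Real.log (1 - x) -
      (Real.log (1 + x) + Real.log (1 - x))) (Set.Ico 0 1) := by
    have hd : ∀ x ∈ Set.Ico (0 : ℝ) 1, HasDerivAt
        (fun x : ℝ => Real.log (1 + x) * Real.log (1 - x) -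
          (Real.log (1 + x) + Real.log (1 - x)))
        (((1 - x) * Real.log (1 - x) - (1 + x) * Real.log (1 + x) + 2 * x) /
          ((1 - x) * (1 + x))) x := by
      intro x hx
      have h1 : (1 - x) ≠ 0 := by linarith [hx.2]
      have h2 : (1 + x) ≠ 0 := by linarith [hx.1]
      have e1 : HasDerivAt (fun x : ℝ => 1 - x) (-1) x := by
        simpa using (hasDerivAt_id x).const_sub 1
      have e2 : HasDerivAt (fun x : ℝ => 1 + x) 1 x := by
        simpa using (hasDerivAt_id x).const_add 1
      refine (((e2.log h2).mul (e1.log h1)).sub ((e2.log h2).add (e1.log h1))).congr_deriv ?_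
      field_simp
      ring
    refine monotoneOn_of_deriv_nonneg (convex_Ico 0 1)
      (fun x hx => (hd x hx).continuousAt.continuousWithinAt)
      (fun x hx => (hd x (interior_subset hx)).differentiableAt.differentiableWithinAt) ?_
    intro x hx
    have hx' := interior_subset hx
    rw [(hd x hx').deriv]
    have := hN (⟨le_rfl, one_pos⟩ : (0 : ℝ) ∈ Set.Ico (0 : ℝ) 1) hx' hx'.1
    simp only [sub_zero, add_zero, Real.log_one, mul_zero] at this
    exact div_nonneg this (mul_nonneg (by linarith [hx'.2]) (by linarith [hx'.1]))
  have := hφ (⟨le_rfl, one_pos⟩ : (0 : ℝ) ∈ Set.Ico (0 : ℝ) 1) ⟨h0, h1⟩ h0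
  simp only [sub_zero, add_zero, Real.log_one, mul_zero] at this
  linarith

/-- With `p = log(1 + r)` and `q = log(1 - r)`, this is positivity of the quadratic form with matrix
`[[1 - p, -1], [-1, 1 - q]]`: `p < 1`, and the determinant is `pq - p - q ≥ 0`. The proof completes
the square after multiplying by `1 - p`. -/
theorem sq_mul_log_add_sq_mul_log_le {r : ℝ} (h0 : 0 ≤ r) (h1 : r < 1) (a b : ℝ) :
    a ^ 2 * Real.log (1 + r) + b ^ 2 * Real.log (1 - r) ≤ (a - b) ^ 2 := by
  have h := log_one_sub_sq_le_mul_log h0 h1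
  have hp : Real.log (1 + r) < 1 := by
    have := Real.log_lt_sub_one_of_pos (x := 1 + r)
    rcases h0.eq_or_lt with rfl | h0
    · simp
    · linarith [this (by linarith) (by linarith)]
  set p := Real.log (1 + r)
  set q := Real.log (1 - r)
  have key : 0 ≤ (1 - p) * (a ^ 2 * (1 - p) - 2 * a * b + b ^ 2 * (1 - q)) := by
    nlinarith [sq_nonneg (a * (1 - p) - b), mul_nonneg (sq_nonneg b) (sub_nonneg.2 h)]
  have := nonneg_of_mul_nonneg_right key (by linarith)
  nlinarith

/-- The two-point logarithmic Sobolev inequality, in dual form. -/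
theorem two_point_log_sobolev (a b : ℝ) {s t : ℝ} (hs : 0 < s) (ht : 0 < t) :
    a ^ 2 * Real.log s + b ^ 2 * Real.log t ≤
      (a ^ 2 + b ^ 2) * Real.log ((s + t) / 2) + (a - b) ^ 2 := by
  wlog hst : t ≤ s generalizing a b s t
  · have := this b a ht hs (le_of_not_ge hst)
    rw [add_comm t s] at this
    nlinarith
  have hm : 0 < (s + t) / 2 := by positivity
  -- Dividing `s` and `t` by their mean turns them into `1 + r` and `1 - r`.
  have h := sq_mul_log_add_sq_mul_log_le (r := (s - t) / (s + t))
    (div_nonneg (by linarith) (by linarith)) (by rw [div_lt_one (by linarith)]; linarith) a b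
  have e1 : 1 + (s - t) / (s + t) = s / ((s + t) / 2) := by field_simp; ring
  have e2 : 1 - (s - t) / (s + t) = t / ((s + t) / 2) := by field_simp; ring
  rw [e1, e2, Real.log_div hs.ne' hm.ne', Real.log_div ht.ne' hm.ne'] at h
  linarith

/-! ### Functional inequalities on the hypercube -/

/-- The Dirichlet form `½ ∑ᵢ ∑_z (u(z) - u(flip i z))²` of the hypercube. -/
noncomputable def dirichlet {n : ℕ} (u : Assignment n → ℝ) : ℝ :=
  (1 / 2) * ∑ i, ∑ z, (u z - u (flip i z)) ^ 2

theorem flip_zero_cons {n : ℕ} (s : ℤˣ) (z : Assignment n) :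
    flip 0 (Fin.cons s z : Assignment (n + 1)) = (Fin.cons (-s) z : Assignment (n + 1)) := by
  simp [flip, Fin.update_cons_zero]

theorem flip_succ_cons {n : ℕ} (i : Fin n) (s : ℤˣ) (z : Assignment n) :
    flip i.succ (Fin.cons s z : Assignment (n + 1)) =
      (Fin.cons s (flip i z) : Assignment (n + 1)) := by
  simp [flip, Fin.cons_update]

theorem flip_flip {n : ℕ} (i : Fin n) (z : Assignment n) : flip i (flip i z) = z := by
  simp [flip]

theorem sum_comp_flip {n : ℕ} {M : Type*} [AddCommMonoid M] (i : Fin n) (f : Assignment n → M) :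
    ∑ z, f (flip i z) = ∑ z, f z :=
  Equiv.sum_comp (Function.Involutive.toPerm (flip i) (flip_flip i)) f

theorem card_assignment (n : ℕ) : Fintype.card (Assignment n) = 2 ^ n := by
  simp [Assignment]

theorem sum_assignment_succ {n : ℕ} {M : Type*} [AddCommMonoid M] (f : Assignment (n + 1) → M) :
    ∑ z, f z = ∑ z : Assignment n, f (Fin.cons 1 z : Assignment (n + 1)) +
      ∑ z : Assignment n, f (Fin.cons (-1) z : Assignment (n + 1)) := by
  rw [← (Fin.consEquiv fun _ : Fin (n + 1) => ℤˣ).sum_comp, Fintype.sum_prod_type,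
    show (univ : Finset ℤˣ) = {1, -1} from rfl, sum_pair (by decide)]
  rfl

theorem dirichlet_succ {n : ℕ} (u : Assignment (n + 1) → ℝ) :
    dirichlet u = dirichlet (fun z : Assignment n => u (Fin.cons 1 z : Assignment (n + 1))) +
      dirichlet (fun z : Assignment n => u (Fin.cons (-1) z : Assignment (n + 1))) +
      ∑ z : Assignment n, (u (Fin.cons 1 z : Assignment (n + 1)) -
        u (Fin.cons (-1) z : Assignment (n + 1))) ^ 2 := by
  simp only [dirichlet, Fin.sum_univ_succ, sum_assignment_succ, flip_zero_cons, flip_succ_cons,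
    neg_neg, sum_add_distrib]
  have : ∑ z : Assignment n, (u (Fin.cons (-1) z : Assignment (n + 1)) -
      u (Fin.cons 1 z : Assignment (n + 1))) ^ 2 =
      ∑ z : Assignment n, (u (Fin.cons 1 z : Assignment (n + 1)) -
        u (Fin.cons (-1) z : Assignment (n + 1))) ^ 2 :=
    sum_congr rfl fun z _ => by ring
  rw [this]
  ring

/-- The reverse triangle inequality in `ℓ²`; it lets the two-point inequality act on the norms of
the two halves of the cube. -/
theorem sqrt_sum_sq_sub_sq_le {ι : Type*} (s : Finset ι) (u v : ι → ℝ) :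
    (√(∑ i ∈ s, u i ^ 2) - √(∑ i ∈ s, v i ^ 2)) ^ 2 ≤ ∑ i ∈ s, (u i - v i) ^ 2 := by
  have h := Real.sum_mul_le_sqrt_mul_sqrt s u v
  have hu := Real.sq_sqrt (sum_nonneg fun i (_ : i ∈ s) => sq_nonneg (u i))
  have hv := Real.sq_sqrt (sum_nonneg fun i (_ : i ∈ s) => sq_nonneg (v i))
  have e : ∑ i ∈ s, (u i - v i) ^ 2 =
      ∑ i ∈ s, u i ^ 2 - 2 * ∑ i ∈ s, u i * v i + ∑ i ∈ s, v i ^ 2 := by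
    rw [mul_sum, ← sum_sub_distrib, ← sum_add_distrib]
    exact sum_congr rfl fun i _ => by ring
  rw [e, sub_sq, hu, hv]
  linarith

/-- The logarithmic Sobolev inequality on the hypercube, in dual form. -/
theorem log_sobolev {n : ℕ} (u F : Assignment n → ℝ) :
    ∑ z, u z ^ 2 * F z ≤
      (∑ z, u z ^ 2) * Real.log ((∑ z, Real.exp (F z)) / 2 ^ n) + dirichlet u := by
  induction n with
  | zero => simp [dirichlet]
  | succ n ih =>
    rw [dirichlet_succ]
    simp only [sum_assignment_succ]
    set u₁ := fun z : Assignment n => u (Fin.cons 1 z : Assignment (n + 1))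
    set u₂ := fun z : Assignment n => u (Fin.cons (-1) z : Assignment (n + 1))
    set F₁ := fun z : Assignment n => F (Fin.cons 1 z : Assignment (n + 1))
    set F₂ := fun z : Assignment n => F (Fin.cons (-1) z : Assignment (n + 1))
    have h₁ := ih u₁ F₁
    have h₂ := ih u₂ F₂
    have p₁ : 0 < (∑ z, Real.exp (F₁ z)) / 2 ^ n :=
      div_pos (sum_pos (fun z _ => Real.exp_pos _) univ_nonempty) (by positivity)
    have p₂ : 0 < (∑ z, Real.exp (F₂ z)) / 2 ^ n :=
      div_pos (sum_pos (fun z _ => Real.exp_pos _) univ_nonempty) (by positivity)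
    -- Tensorization: the two-point inequality is applied to the norms of the halves and their
    -- exponential means; `hs` bounds its error by the Dirichlet energy along the new coordinate.
    have h := two_point_log_sobolev (√(∑ z, u₁ z ^ 2)) (√(∑ z, u₂ z ^ 2)) p₁ p₂
    have hs := sqrt_sum_sq_sub_sq_le univ u₁ u₂
    rw [Real.sq_sqrt (sum_nonneg fun i _ => sq_nonneg _),
      Real.sq_sqrt (sum_nonneg fun i _ => sq_nonneg _), ← add_div, div_div, ← pow_succ] at h
    change ∑ z, u₁ z ^ 2 * F₁ z + ∑ z, u₂ z ^ 2 * F₂ z ≤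
      (∑ z, u₁ z ^ 2 + ∑ z, u₂ z ^ 2) *
        Real.log ((∑ z, Real.exp (F₁ z) + ∑ z, Real.exp (F₂ z)) / 2 ^ (n + 1)) +
      (dirichlet u₁ + dirichlet u₂ + ∑ z, (u₁ z - u₂ z) ^ 2)
    linarith

/-- The Poincaré inequality on the hypercube. -/
theorem poincare {n : ℕ} (u : Assignment n → ℝ) :
    2 * ∑ z, u z ^ 2 ≤ 2 * ((∑ z, u z) ^ 2 / 2 ^ n) + dirichlet u := by
  induction n with
  | zero => simp [dirichlet]
  | succ n ih =>
    rw [dirichlet_succ]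
    simp only [sum_assignment_succ]
    set u₁ := fun z : Assignment n => u (Fin.cons 1 z : Assignment (n + 1))
    set u₂ := fun z : Assignment n => u (Fin.cons (-1) z : Assignment (n + 1))
    have h₁ := ih u₁
    have h₂ := ih u₂
    -- Cauchy–Schwarz: the squared difference of the half sums, lost on merging the means, is paid
    -- for by the edges along the new coordinate.
    have hc := sq_sum_le_card_mul_sum_sq (s := univ) (f := fun z => u₁ z - u₂ z)
    rw [card_univ, card_assignment, sum_sub_distrib, Nat.cast_pow, Nat.cast_ofNat] at hc
    change 2 * (∑ z, u₁ z ^ 2 + ∑ z, u₂ z ^ 2) ≤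
      2 * ((∑ z, u₁ z + ∑ z, u₂ z) ^ 2 / 2 ^ (n + 1)) +
      (dirichlet u₁ + dirichlet u₂ + ∑ z, (u₁ z - u₂ z) ^ 2)
    have hc' : (∑ z, u₁ z - ∑ z, u₂ z) ^ 2 / 2 ^ n ≤ ∑ z, (u₁ z - u₂ z) ^ 2 := by
      rw [div_le_iff₀ (by positivity)]
      linarith
    have e : 2 * ((∑ z, u₁ z) ^ 2 / 2 ^ n) + 2 * ((∑ z, u₂ z) ^ 2 / 2 ^ n) =
        2 * ((∑ z, u₁ z + ∑ z, u₂ z) ^ 2 / 2 ^ (n + 1)) +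
          (∑ z, u₁ z - ∑ z, u₂ z) ^ 2 / 2 ^ n := by
      rw [pow_succ]
      field_simp
      ring
    linarith

theorem dirichlet_eq {n : ℕ} (u : Assignment n → ℝ) :
    dirichlet u = n * ∑ z, u z ^ 2 - ∑ z, u z * ∑ i, u (flip i z) := by
  have h : ∀ i : Fin n, ∑ z, (u z - u (flip i z)) ^ 2 =
      2 * ∑ z, u z ^ 2 - 2 * ∑ z, u z * u (flip i z) := by
    intro i
    have := sum_comp_flip i fun z => u z ^ 2
    have e : ∑ z, (u z - u (flip i z)) ^ 2 =
        ∑ z, u z ^ 2 - 2 * ∑ z, u z * u (flip i z) + ∑ z, u (flip i z) ^ 2 := by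
      rw [mul_sum, ← sum_sub_distrib, ← sum_add_distrib]
      exact sum_congr rfl fun i _ => by ring
    rw [e, this]
    ring
  simp only [dirichlet, h, sum_sub_distrib, ← mul_sum, sum_const, card_univ, Fintype.card_fin,
    nsmul_eq_mul]
  rw [sum_comm]
  simp only [← mul_sum]
  ring

/-! ### Quadratic-form bounds -/

/-- The quadratic form of `-X/n + b·W` on real vectors. -/
noncomputable def energyForm {n : ℕ} (b : ℝ) (W : Assignment n → ℝ) (u : Assignment n → ℝ) : ℝ :=
  ∑ z, u z * (-(1 / n) * ∑ i, u (flip i z) + b * W z * u z)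

theorem energyForm_eq {n : ℕ} (hn : 1 ≤ n) (b : ℝ) (W u : Assignment n → ℝ) :
    n * energyForm b W u = dirichlet u - n * ∑ z, u z ^ 2 + n * b * ∑ z, u z ^ 2 * W z := by
  have hn' : (n : ℝ) ≠ 0 := by positivity
  rw [dirichlet_eq, energyForm, mul_sum, mul_sum, mul_sum]
  simp only [sub_sub_cancel_left]
  rw [← sum_neg_distrib, ← sum_add_distrib]
  refine sum_congr rfl fun z _ => ?_
  field_simp

theorem g_nonpos (η x : ℝ) : g η x ≤ 0 := by
  unfold g
  split_ifs <;> simp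

theorem neg_one_le_g {η x : ℝ} (hη : 0 ≤ η) (hx : -1 ≤ x) : -1 ≤ g η x := by
  unfold g
  split_ifs with h
  · rfl
  · norm_num
  · have : 0 < η := lt_of_le_of_ne hη (Ne.symm h)
    refine le_min (by norm_num) ?_
    rw [le_div_iff₀ this]
    linarith

theorem g_eq_zero {η x : ℝ} (hη : 0 ≤ η) (hx : -(1 - η) < x) : g η x = 0 := by
  unfold g
  split_ifs with h h'
  · subst h
    linarith
  · rfl
  · exact min_eq_left (div_nonneg (by linarith) hη)

theorem optimalCost_le {n : ℕ} (H : Assignment n → ℝ) (z : Assignment n) : optimalCost H ≤ H z :=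
  inf'_le _ (mem_univ z)

theorem optimalCost_nonpos {n : ℕ} {H : Assignment n → ℝ} (hH : ∑ z, H z = 0) :
    optimalCost H ≤ 0 := by
  by_contra h
  have : 0 < ∑ z, H z := sum_pos (fun z _ => (not_le.1 h).trans_le (optimalCost_le H z))
    univ_nonempty
  linarith

theorem cumulativeCount_eq_card {n : ℕ} (H : Assignment n → ℝ) (E : ℝ) :
    cumulativeCount H E = #{z | H z ≤ E} := by
  rw [cumulativeCount, ← Set.ncard_coe_finset]
  simp

theorem one_le_cumulativeCount {n : ℕ} {H : Assignment n → ℝ} (hH : ∑ z, H z = 0) {η : ℝ}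
    (hη : 0 ≤ η) : 1 ≤ cumulativeCount H ((1 - η) * optimalCost H) := by
  obtain ⟨z, -, hz⟩ := exists_mem_eq_inf' univ_nonempty H
  rw [cumulativeCount_eq_card, Nat.one_le_iff_ne_zero, ← Nat.pos_iff_ne_zero, card_pos]
  refine ⟨z, mem_filter.2 ⟨mem_univ _, ?_⟩⟩
  rw [← hz]
  change optimalCost H ≤ _
  nlinarith [optimalCost_nonpos hH]

/-- If the minimum were `0`, then `H` would vanish identically and all `2ⁿ` assignments would be
counted, too many for `γ > 0`. -/
theorem optimalCost_neg {n : ℕ} (hn : 1 ≤ n) {H : Assignment n → ℝ} (hH : ∑ z, H z = 0)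
    {η γ : ℝ} (hγ : 0 < γ)
    (htail : (cumulativeCount H ((1 - η) * optimalCost H) : ℝ) ≤ (2 : ℝ) ^ ((1 - γ) * (n : ℝ))) :
    optimalCost H < 0 := by
  refine (optimalCost_nonpos hH).lt_of_ne fun h => ?_
  have hz : ∀ z, H z = 0 := fun z =>
    (sum_eq_zero_iff_of_nonneg fun z _ => h ▸ optimalCost_le H z).1 hH z (mem_univ z)
  have hn' : (0 : ℝ) < n := by positivity
  rw [cumulativeCount_eq_card, h] at htail
  simp only [hz, mul_zero, le_refl, filter_true, card_univ, card_assignment] at htail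
  have : (2 : ℝ) ^ ((1 - γ) * (n : ℝ)) < 2 ^ (n : ℝ) :=
    Real.rpow_lt_rpow_of_exponent_lt one_lt_two (by nlinarith)
  rw [Real.rpow_natCast] at this
  push_cast at htail
  linarith

theorem neg_one_le_cost_div {n : ℕ} {H : Assignment n → ℝ} (h : optimalCost H < 0)
    (z : Assignment n) : -1 ≤ H z / |optimalCost H| := by
  rw [abs_of_neg h, le_div_iff₀ (neg_pos.2 h)]
  linarith [optimalCost_le H z]

/-- The exponential moment of `-g_η(H/|E*|)` is controlled by the tail count. -/
theorem sum_exp_le {n : ℕ} {H : Assignment n → ℝ} (hE : optimalCost H < 0) {η : ℝ} (hη : 0 ≤ η)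
    {c : ℝ} (hc : 0 ≤ c) :
    ∑ z, Real.exp (-(c * g η (H z / |optimalCost H|))) ≤
      2 ^ n + cumulativeCount H ((1 - η) * optimalCost H) * (Real.exp c - 1) := by
  have e : (2 : ℝ) ^ n + cumulativeCount H ((1 - η) * optimalCost H) * (Real.exp c - 1) =
      ∑ z : Assignment n,
        (1 + if H z ≤ (1 - η) * optimalCost H then Real.exp c - 1 else 0) := by
    rw [sum_add_distrib, ← sum_filter, sum_const, sum_const, cumulativeCount_eq_card, card_univ,
      card_assignment]
    simp
  rw [e]
  refine sum_le_sum fun z _ => ?_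
  split_ifs with h
  · have := neg_one_le_g hη (neg_one_le_cost_div hE z)
    rw [add_sub_cancel, Real.exp_le_exp]
    nlinarith
  · rw [g_eq_zero hη]
    · simp
    · rw [abs_of_neg hE, lt_div_iff₀ (neg_pos.2 hE)]
      linarith [not_le.1 h]

theorem exp_mul_le_rpow {n : ℕ} {γ c s : ℝ} (hc : c ≤ Real.log 2 * γ * s * n) :
    Real.exp c ≤ (2 : ℝ) ^ (γ * s * n) := by
  rw [Real.rpow_def_of_pos two_pos, Real.exp_le_exp]
  linarith

theorem energyForm_ge {n : ℕ} (hn : 1 ≤ n) {H : Assignment n → ℝ}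
    (hH : ∑ z, H z = 0) {η γ : ℝ} (hη₀ : 0 ≤ η)
    (htail : (cumulativeCount H ((1 - η) * optimalCost H) : ℝ) ≤ (2 : ℝ) ^ ((1 - γ) * (n : ℝ)))
    (hγ : (1 + 4 * Real.logb 2 (n : ℝ)) / (n : ℝ) ≤ γ)
    {b : ℝ} (hb₀ : 0 ≤ b) (hb : b ≤ Real.log 2 * γ / (2 + Real.log 2)) (u : Assignment n → ℝ) :
    (-1 - 1 / (n : ℝ) ^ 3) * ∑ z, u z ^ 2 ≤
      energyForm b (fun z => g η (H z / |optimalCost H|)) u := by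
  have hn' : (0 : ℝ) < n := by positivity
  have hn1 : (1 : ℝ) ≤ n := by exact_mod_cast hn
  have hlogn : 0 ≤ Real.logb 2 n := Real.logb_nonneg one_lt_two hn1
  rw [div_le_iff₀ hn'] at hγ
  have hγ0 : 0 < γ := pos_of_mul_pos_left (by linarith : 0 < γ * n) hn'.le
  have hE := optimalCost_neg hn hH hγ0 htail
  have hl2 : 0 < Real.log 2 := Real.log_pos one_lt_two
  have hb2 : b ≤ Real.log 2 * γ / 2 :=
    hb.trans (div_le_div_of_nonneg_left (by positivity) two_pos (by linarith))
  set W := fun z => g η (H z / |optimalCost H|)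
  set M := (∑ z, Real.exp (-(n * b * W z))) / 2 ^ n with hM
  have hMpos : 0 < M :=
    div_pos (sum_pos (fun z _ => Real.exp_pos _) univ_nonempty) (by positivity)
  have hMle : M ≤ 1 + 1 / (n : ℝ) ^ 2 := by
    have h1 := sum_exp_le hE hη₀ (c := n * b) (by positivity)
    -- The exponential uses only half of the saving `2^(-γn)`; the other half, `2^(-γn/2)`, is at
    -- most `1/n²` because `γn ≥ 1 + 4 log₂ n`.
    have h2 : Real.exp (n * b) ≤ (2 : ℝ) ^ (γ * (1 / 2) * n) :=
      exp_mul_le_rpow (by nlinarith)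
    have h3 : (cumulativeCount H ((1 - η) * optimalCost H) : ℝ) * (Real.exp (n * b) - 1) ≤
        (2 : ℝ) ^ ((1 - γ) * (n : ℝ)) * (2 : ℝ) ^ (γ * (1 / 2) * n) :=
      mul_le_mul htail (by linarith) (by linarith [Real.one_le_exp (by positivity : 0 ≤ n * b)])
        (by positivity)
    have h4 : (2 : ℝ) ^ ((1 - γ) * (n : ℝ)) * (2 : ℝ) ^ (γ * (1 / 2) * n) ≤
        2 ^ n * (1 / (n : ℝ) ^ 2) := by
      have e : (1 / (n : ℝ) ^ 2) = (2 : ℝ) ^ (Real.logb 2 n * (-2)) := by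
        rw [Real.rpow_mul zero_le_two, Real.rpow_logb two_pos (by norm_num) hn',
          Real.rpow_neg hn'.le, one_div]
        norm_cast
      rw [e, ← Real.rpow_natCast 2 n, ← Real.rpow_add two_pos, ← Real.rpow_add two_pos]
      exact Real.rpow_le_rpow_of_exponent_le one_le_two (by nlinarith)
    rw [hM, div_le_iff₀ (by positivity)]
    linarith
  have hlog : Real.log M ≤ 1 / (n : ℝ) ^ 2 := by linarith [Real.log_le_sub_one_of_pos hMpos]
  have hLS := log_sobolev u fun z => -(n * b * W z)
  have e1 : ∑ z, u z ^ 2 * -(n * b * W z) = -(n * b * ∑ z, u z ^ 2 * W z) := by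
    rw [mul_sum, ← sum_neg_distrib]
    exact sum_congr rfl fun z _ => by ring
  rw [e1] at hLS
  have hA : 0 ≤ ∑ z, u z ^ 2 := sum_nonneg fun z _ => sq_nonneg _
  have h5 := mul_le_mul_of_nonneg_left hlog hA
  have h6 := energyForm_eq hn b W u
  have h7 : n * ((-1 - 1 / (n : ℝ) ^ 3) * ∑ z, u z ^ 2) =
      -n * ∑ z, u z ^ 2 - (∑ z, u z ^ 2) * (1 / (n : ℝ) ^ 2) := by
    field_simp
  refine le_of_mul_le_mul_left ?_ hn'
  rw [h6, h7]
  linarith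

theorem energyForm_gt_of_sum_eq_zero {n : ℕ} (hn : 1 ≤ n) {H : Assignment n → ℝ}
    (hH : ∑ z, H z = 0) {η γ : ℝ} (hη₀ : 0 ≤ η)
    (htail : (cumulativeCount H ((1 - η) * optimalCost H) : ℝ) ≤ (2 : ℝ) ^ ((1 - γ) * (n : ℝ)))
    (hγ : 0 < γ) {b : ℝ} (hb₀ : 0 ≤ b) (hb : b ≤ Real.log 2 * γ / (2 + Real.log 2))
    {u : Assignment n → ℝ} (hu : ∑ z, u z = 0) (hu0 : u ≠ 0) :
    (-1 + 1 / (n : ℝ)) * ∑ z, u z ^ 2 <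
      energyForm b (fun z => g η (H z / |optimalCost H|)) u := by
  have hn' : (0 : ℝ) < n := by positivity
  have hE := optimalCost_neg hn hH hγ htail
  have hl2 : 0 < Real.log 2 := Real.log_pos one_lt_two
  rw [le_div_iff₀ (by linarith)] at hb
  set W := fun z => g η (H z / |optimalCost H|)
  -- The largest multiple that the bound on `b` allows: `c ≤ ln(2)·γn`, so that `exp c ≤ 2^(γn)` and
  -- `M < 2`.
  set c := n * b * (2 + Real.log 2) with hc
  set M := (∑ z, Real.exp (-(c * W z))) / 2 ^ n with hM
  have hMpos : 0 < M :=
    div_pos (sum_pos (fun z _ => Real.exp_pos _) univ_nonempty) (by positivity)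
  have hMlt : M < 2 := by
    have h1 := sum_exp_le hE hη₀ (c := c) (by positivity)
    have h2 : Real.exp c ≤ (2 : ℝ) ^ (γ * 1 * n) := exp_mul_le_rpow (by nlinarith)
    have h3 : (cumulativeCount H ((1 - η) * optimalCost H) : ℝ) * Real.exp c ≤
        (2 : ℝ) ^ ((1 - γ) * (n : ℝ)) * (2 : ℝ) ^ (γ * 1 * n) :=
      mul_le_mul htail h2 (Real.exp_pos _).le (by positivity)
    have h4 : (2 : ℝ) ^ ((1 - γ) * (n : ℝ)) * (2 : ℝ) ^ (γ * 1 * n) = 2 ^ n := by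
      rw [← Real.rpow_natCast 2 n, ← Real.rpow_add two_pos]
      congr 1
      ring
    -- The `-1` in `exp c - 1`, weighted by a nonzero count, makes `M < 2` strict.
    have h5 : (1 : ℝ) ≤ cumulativeCount H ((1 - η) * optimalCost H) := by
      exact_mod_cast one_le_cumulativeCount hH hη₀
    rw [hM, div_lt_iff₀ (by positivity)]
    linarith
  have hlog : Real.log M < Real.log 2 := Real.log_lt_log hMpos hMlt
  have hLS := log_sobolev u fun z => -(c * W z)
  have e1 : ∑ z, u z ^ 2 * -(c * W z) = -(c * ∑ z, u z ^ 2 * W z) := by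
    rw [mul_sum, ← sum_neg_distrib]
    exact sum_congr rfl fun z _ => by ring
  rw [e1] at hLS
  have hP := poincare u
  rw [hu] at hP
  have hA : 0 < ∑ z, u z ^ 2 := by
    obtain ⟨z, hz⟩ := Function.ne_iff.1 hu0
    exact sum_pos' (fun z _ => sq_nonneg _) ⟨z, mem_univ z, sq_pos_of_ne_zero hz⟩
  have h5 := mul_lt_mul_of_pos_left hlog hA
  have h6 := energyForm_eq hn b W u
  have h7 : n * ((-1 + 1 / (n : ℝ)) * ∑ z, u z ^ 2) = -n * ∑ z, u z ^ 2 + ∑ z, u z ^ 2 := by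
    field_simp
  refine lt_of_mul_lt_mul_left ?_ hn'.le
  rw [h6, h7]
  refine lt_of_mul_lt_mul_left ?_ (by linarith : 0 ≤ 2 + Real.log 2)
  rw [hc] at hLS
  norm_num at hP
  -- After scaling by `2 + ln 2`, log-Sobolev uses one Dirichlet form and costs less than
  -- `ln(2)‖u‖²`. The remaining `1 + ln 2` copies give at least `(2 + 2 ln 2)‖u‖²`, leaving exactly
  -- the required `(2 + ln 2)‖u‖²`.
  have h8 := mul_le_mul_of_nonneg_left hP (by linarith : 0 ≤ 1 + Real.log 2)
  linarith

open Matrix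

open scoped ComplexOrder

/-! ### Spectral consequences -/

theorem eq_flip_iff {n : ℕ} (i : Fin n) (z w : Assignment n) : z = flip i w ↔ w = flip i z :=
  ⟨fun h => by rw [h, flip_flip], fun h => by rw [h, flip_flip]⟩

theorem hamiltonian_mulVec {n : ℕ} (H : Assignment n → ℝ) (η b : ℝ) (ψ : Assignment n → ℂ)
    (z : Assignment n) :
    (hamiltonian H η b *ᵥ ψ) z = -(1 / (n : ℂ)) * ∑ i, ψ (flip i z) +
      b * ((g η (H z / |optimalCost H|) : ℝ) : ℂ) * ψ z := by
  have h : ∀ i : Fin n, (pauliX i *ᵥ ψ) z = ψ (flip i z) := by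
    intro i
    simp [pauliX, mulVec, dotProduct, eq_flip_iff i z]
  simp only [hamiltonian, transverseField, add_mulVec, neg_mulVec, smul_mulVec, sum_mulVec,
    Pi.add_apply, Pi.neg_apply, Pi.smul_apply, Finset.sum_apply, h, mulVec_diagonal, smul_eq_mul]
  ring

theorem hamiltonian_isHermitian {n : ℕ} (H : Assignment n → ℝ) (η b : ℝ) :
    (hamiltonian H η b).IsHermitian := by
  have hX : ∀ i : Fin n, (pauliX i)ᴴ = pauliX i := by
    intro i
    ext z w
    simp [pauliX, conjTranspose_apply, eq_flip_iff i w, apply_ite]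
  simp only [IsHermitian, hamiltonian, transverseField, conjTranspose_add, conjTranspose_neg,
    conjTranspose_smul, conjTranspose_sum, hX, diagonal_conjTranspose]
  congr 2
  · simp
  · simp
  · congr 1
    ext z
    simp

/-- The matrix is real and symmetric, so real and imaginary parts decouple and the inequalities for
real vectors suffice. -/
theorem re_star_dotProduct_hamiltonian {n : ℕ} (H : Assignment n → ℝ) (η b : ℝ)
    (ψ : Assignment n → ℂ) :
    (star ψ ⬝ᵥ (hamiltonian H η b *ᵥ ψ)).re =
      energyForm b (fun z => g η (H z / |optimalCost H|)) (fun z => (ψ z).re) +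
      energyForm b (fun z => g η (H z / |optimalCost H|)) (fun z => (ψ z).im) := by
  simp only [dotProduct, Complex.re_sum, energyForm, ← sum_add_distrib]
  refine sum_congr rfl fun z _ => ?_
  rw [hamiltonian_mulVec]
  have e : -(1 / (n : ℂ)) * ∑ i, ψ (flip i z) +
      b * ((g η (H z / |optimalCost H|) : ℝ) : ℂ) * ψ z =
      ((-(1 / n) : ℝ) : ℂ) * ∑ i, ψ (flip i z) +
        ((b * g η (H z / |optimalCost H|) : ℝ) : ℂ) * ψ z := by
    push_cast
    rfl
  rw [e]
  simp only [Pi.star_apply, RCLike.star_def, Complex.mul_re, Complex.conj_re, Complex.conj_im,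
    Complex.add_re, Complex.add_im, Complex.mul_im, Complex.ofReal_re, Complex.ofReal_im,
    Complex.re_sum, Complex.im_sum]
  ring

theorem re_star_dotProduct_self {n : ℕ} (ψ : Assignment n → ℂ) :
    (star ψ ⬝ᵥ ψ).re = ∑ z, (ψ z).re ^ 2 + ∑ z, (ψ z).im ^ 2 := by
  simp only [dotProduct, Complex.re_sum, ← sum_add_distrib]
  refine sum_congr rfl fun z _ => ?_
  simp only [Pi.star_apply, RCLike.star_def, Complex.mul_re, Complex.conj_re, Complex.conj_im]
  ring

theorem re_star_dotProduct_self_pos {n : ℕ} {ψ : Assignment n → ℂ} (h : ψ ≠ 0) :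
    0 < (star ψ ⬝ᵥ ψ).re :=
  (Complex.pos_iff.1 (dotProduct_star_self_pos_iff.2 h)).1

theorem star_dotProduct_mulVec_comm {n : ℕ} {K : Operator n} (hK : K.IsHermitian)
    (φ ψ : Assignment n → ℂ) : star φ ⬝ᵥ (K *ᵥ ψ) = star (K *ᵥ φ) ⬝ᵥ ψ := by
  rw [star_mulVec, hK.eq, dotProduct_mulVec]

theorem star_dotProduct_eq_zero {n : ℕ} {K : Operator n} (hK : K.IsHermitian) {E F : ℝ}
    (hEF : E ≠ F) {φ ψ : Assignment n → ℂ} (hφ : K *ᵥ φ = (E : ℂ) • φ)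
    (hψ : K *ᵥ ψ = (F : ℂ) • ψ) : star φ ⬝ᵥ ψ = 0 := by
  have h := star_dotProduct_mulVec_comm hK φ ψ
  rw [hφ, hψ, dotProduct_smul, star_smul, smul_dotProduct, smul_eq_mul, smul_eq_mul,
    RCLike.star_def, Complex.conj_ofReal, ← sub_eq_zero, ← sub_mul] at h
  refine (mul_eq_zero.1 h).resolve_left fun h' => hEF ?_
  exact_mod_cast (sub_eq_zero.1 h').symm

theorem mem_energies_iff {n : ℕ} {K : Operator n} {E : ℝ} :
    E ∈ energies K ↔ ∃ ψ : Assignment n → ℂ, K *ᵥ ψ = (E : ℂ) • ψ ∧ ψ ≠ 0 := by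
  constructor
  · intro h
    obtain ⟨ψ, hψ⟩ := Module.End.HasEigenvalue.exists_hasEigenvector h
    exact ⟨ψ, by simpa using hψ.apply_eq_smul, hψ.2⟩
  · rintro ⟨ψ, hψ, h0⟩
    exact Module.End.hasEigenvalue_of_hasEigenvector
      (Module.End.hasEigenvector_iff.2 ⟨Module.End.mem_eigenspace_iff.2 (by simpa using hψ), h0⟩)

theorem energies_finite {n : ℕ} (K : Operator n) : (energies K).Finite :=
  Set.Finite.preimage Complex.ofReal_injective.injOn
    (Module.End.finite_hasEigenvalue (Matrix.toLin' K))

/-- The variational principle. -/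
theorem exists_mem_energies_le {n : ℕ} {K : Operator n} (hK : K.IsHermitian) {c : ℝ}
    {ψ : Assignment n → ℂ} (h0 : ψ ≠ 0)
    (h : (star ψ ⬝ᵥ (K *ᵥ ψ)).re ≤ c * (star ψ ⬝ᵥ ψ).re) : ∃ E ∈ energies K, E ≤ c := by
  by_contra! hc
  have hA : (K - (c : ℂ) • (1 : Operator n)).IsHermitian := by
    -- If every energy exceeded `c`, then `K - c` would be positive definite, contradicting the
    -- trial vector.
    refine hK.sub ?_
    simp [IsHermitian, conjTranspose_smul]
  have hpd : (K - (c : ℂ) • (1 : Operator n)).PosDef := by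
    refine hA.posDef_iff_eigenvalues_pos.2 fun j => ?_
    have hj := hA.mulVec_eigenvectorBasis j
    have hmem : hA.eigenvalues j + c ∈ energies K := by
      refine mem_energies_iff.2 ⟨WithLp.ofLp (hA.eigenvectorBasis j), ?_, ?_⟩
      · rw [sub_mulVec, smul_mulVec, one_mulVec, sub_eq_iff_eq_add] at hj
        rw [hj]
        push_cast
        rw [add_smul]
        rfl
      · intro h'
        refine hA.eigenvectorBasis.orthonormal.ne_zero j ?_
        ext z
        exact congrFun h' z
    linarith [hc _ hmem]
  have := hpd.re_dotProduct_pos h0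
  rw [sub_mulVec, smul_mulVec, one_mulVec, dotProduct_sub, dotProduct_smul] at this
  simp at this
  linarith

theorem groundEnergy_mem {n : ℕ} {K : Operator n} (h : (energies K).Nonempty) :
    groundEnergy K ∈ energies K :=
  h.csInf_mem (energies_finite K)

theorem groundEnergy_le {n : ℕ} {K : Operator n} {E : ℝ} (h : E ∈ energies K) :
    groundEnergy K ≤ E :=
  csInf_le (energies_finite K).bddBelow h

/-- If the quadratic form of a Hermitian operator exceeds `c` on the vectors orthogonal to the
uniform superposition and some energy is at most `c`, then the ground state is non-degenerate and
every excited energy exceeds `c`. -/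
theorem finrank_groundSpace_and_lt_of_form {n : ℕ} {K : Operator n} (hK : K.IsHermitian) {c : ℝ}
    (hform : ∀ ψ : Assignment n → ℂ, ∑ z, ψ z = 0 → ψ ≠ 0 →
      c * (star ψ ⬝ᵥ ψ).re < (star ψ ⬝ᵥ (K *ᵥ ψ)).re)
    (hc : ∃ E ∈ energies K, E ≤ c) :
    Module.finrank ℂ (groundSpace K) = 1 ∧ ∀ E ∈ energies K, E ≠ groundEnergy K → c < E := by
  obtain ⟨E', hE', hE'c⟩ := hc
  have hmem := groundEnergy_mem ⟨E', hE'⟩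
  have hle : groundEnergy K ≤ c := (groundEnergy_le hE').trans hE'c
  have hnn : ∀ ψ : Assignment n → ℂ, 0 ≤ (star ψ ⬝ᵥ ψ).re := fun ψ => by
    rw [re_star_dotProduct_self]
    exact add_nonneg (sum_nonneg fun z _ => sq_nonneg _) (sum_nonneg fun z _ => sq_nonneg _)
  have hform' : ∀ ψ : Assignment n → ℂ, ∀ E : ℝ, E ≤ c → K *ᵥ ψ = (E : ℂ) • ψ →
      ∑ z, ψ z = 0 → ψ = 0 := by
    intro ψ E hE hψ hs
    by_contra h0
    have h := hform ψ hs h0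
    rw [hψ, dotProduct_smul, smul_eq_mul, Complex.re_ofReal_mul] at h
    nlinarith [hnn ψ]
  constructor
  · refine le_antisymm ?_ ?_
    · let σ : groundSpace K →ₗ[ℂ] ℂ :=
        (∑ z, LinearMap.proj z : (Assignment n → ℂ) →ₗ[ℂ] ℂ).comp (groundSpace K).subtype
      have hσ : Function.Injective σ := by
        rw [← LinearMap.ker_eq_bot, LinearMap.ker_eq_bot']
        rintro ⟨ψ, hψ⟩ h
        have h1 := Module.End.mem_eigenspace_iff.1 hψ
        rw [Matrix.toLin'_apply] at h1
        exact Subtype.ext (hform' ψ _ hle h1 (by simpa [σ] using h))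
      simpa using LinearMap.finrank_le_finrank_of_injective hσ
    · rw [Nat.one_le_iff_ne_zero, ← Nat.pos_iff_ne_zero]
      have : groundSpace K ≠ ⊥ := hmem
      exact Submodule.one_le_finrank_iff.2 this
  · intro E hE hne
    by_contra! hEc
    obtain ⟨φ, hφ, hφ0⟩ := mem_energies_iff.1 hmem
    obtain ⟨ψ, hψ, hψ0⟩ := mem_energies_iff.1 hE
    have h1 := star_dotProduct_eq_zero hK hne.symm hφ hψ
    have h2 := star_dotProduct_eq_zero hK hne hψ hφ
    set s := ∑ z, φ z with hs
    set t := ∑ z, ψ z with ht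
    have ht0 : t ≠ 0 := fun h => hψ0 (hform' ψ E hEc hψ h)
    -- Two orthogonal eigenvectors with energies `≤ c` span a plane that meets the sum-zero
    -- hyperplane in this vector, whose form is at most `c` times its squared norm; `t ≠ 0` keeps it
    -- nonzero.
    have hsum : ∑ z, (t • φ - s • ψ) z = 0 := by
      simp only [Pi.sub_apply, Pi.smul_apply, smul_eq_mul, sum_sub_distrib, ← mul_sum, ← hs, ← ht]
      ring
    have hstar : ∀ a b : ℂ, star (t • φ - s • ψ) ⬝ᵥ (a • (t • φ) - b • (s • ψ)) =
        a * (Complex.normSq t * (star φ ⬝ᵥ φ)) + b * (Complex.normSq s * (star ψ ⬝ᵥ ψ)) := by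
      intro a b
      simp only [star_sub, star_smul, sub_dotProduct, dotProduct_sub, smul_dotProduct,
        dotProduct_smul, h1, h2, smul_eq_mul, Complex.normSq_eq_conj_mul_self, RCLike.star_def]
      ring
    have hvec : K *ᵥ (t • φ - s • ψ) =
        (groundEnergy K : ℂ) • (t • φ) - (E : ℂ) • (s • ψ) := by
      rw [mulVec_sub, mulVec_smul, mulVec_smul, hφ, hψ, smul_comm t, smul_comm s]
    have hne0 : t • φ - s • ψ ≠ 0 := by
      intro h
      have h' := congrArg (fun v => star φ ⬝ᵥ v) h
      simp only [dotProduct_sub, dotProduct_smul, h1, smul_zero, sub_zero, dotProduct_zero,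
        smul_eq_zero, ht0, false_or] at h'
      exact hφ0 (dotProduct_star_self_eq_zero.1 h')
    have hlt := hform _ hsum hne0
    have hone := hstar 1 1
    rw [one_smul, one_smul] at hone
    rw [hvec, hstar, hone] at hlt
    simp only [one_mul, Complex.add_re, Complex.re_ofReal_mul] at hlt
    have n1 := mul_nonneg (Complex.normSq_nonneg t) (hnn φ)
    have n2 := mul_nonneg (Complex.normSq_nonneg s) (hnn ψ)
    nlinarith

end ShortPath

theorem mainTheorem6 (n : ℕ) (hn : 1 ≤ n) (H : ShortPath.Assignment n → ℝ)
    (hH : ∑ z, H z = 0) (η γ : ℝ) (hη₀ : 0 ≤ η) (hη₁ : η < 1)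
    (htail : (ShortPath.cumulativeCount H ((1 - η) * ShortPath.optimalCost H) : ℝ) ≤
      (2 : ℝ) ^ ((1 - γ) * (n : ℝ)))
    (hγ : (1 + 4 * Real.logb 2 (n : ℝ)) / (n : ℝ) ≤ γ)
    (b : ℝ) (hb₀ : 0 ≤ b) (hb : b ≤ Real.log 2 * γ / (2 + Real.log 2)) :
    ShortPath.LargeExcitedEnergy (ShortPath.hamiltonian H η b) ∧
      ShortPath.SmallGroundEnergyShift (ShortPath.hamiltonian H η b) := by
  open ShortPath Finset Matrix in
  have hn' : (0 : ℝ) < n := by positivity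
  have hlogn : 0 ≤ Real.logb 2 n := Real.logb_nonneg one_lt_two (by exact_mod_cast hn)
  have hγ0 : 0 < γ := lt_of_lt_of_le (by positivity) hγ
  have hK := hamiltonian_isHermitian H η b
  have hlow : ∃ E ∈ energies (hamiltonian H η b), E ≤ -1 := by
    refine exists_mem_energies_le hK (ψ := fun _ => 1) (fun h => one_ne_zero (congrFun h 1)) ?_
    rw [re_star_dotProduct_hamiltonian, re_star_dotProduct_self]
    simp only [energyForm, Complex.one_re, Complex.one_im, sum_const, card_univ, Fintype.card_fin,
      nsmul_eq_mul, mul_one, one_mul, mul_zero, add_zero, one_pow, ne_eq, OfNat.ofNat_ne_zero,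
      not_false_eq_true, zero_pow]
    have : ∑ _z : Assignment n, (-1 : ℝ) = -1 * Fintype.card (Assignment n) := by
      rw [sum_const, card_univ, nsmul_eq_mul, mul_comm]
    rw [← this]
    refine sum_le_sum fun z _ => ?_
    have hg := mul_nonpos_of_nonneg_of_nonpos hb₀ (g_nonpos η (H z / |optimalCost H|))
    have : -(1 / (n : ℝ)) * n = -1 := by field_simp
    linarith
  have hexc : LargeExcitedEnergy (hamiltonian H η b) := by
    refine finrank_groundSpace_and_lt_of_form hK (fun ψ hs h0 => ?_)
      (hlow.imp fun E hE => ⟨hE.1, hE.2.trans (by linarith [one_div_pos.2 hn'])⟩)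
    have hre : ∑ z, (ψ z).re = 0 := by rw [← Complex.re_sum, hs, Complex.zero_re]
    have him : ∑ z, (ψ z).im = 0 := by rw [← Complex.im_sum, hs, Complex.zero_im]
    have key := fun (u : Assignment n → ℝ) =>
      energyForm_gt_of_sum_eq_zero hn hH hη₀ htail hγ0 hb₀ hb (u := u)
    -- The real or the imaginary part may vanish, so one part needs only the weak inequality.
    have key' : ∀ u : Assignment n → ℝ, ∑ z, u z = 0 → (-1 + 1 / (n : ℝ)) * ∑ z, u z ^ 2 ≤
        energyForm b (fun z => g η (H z / |optimalCost H|)) u := fun u hu => by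
      by_cases h : u = 0
      · simp [h, energyForm]
      · exact (key u hu h).le
    rw [re_star_dotProduct_hamiltonian, re_star_dotProduct_self, mul_add]
    by_cases h : (fun z => (ψ z).re) = 0
    · refine add_lt_add_of_le_of_lt (key' _ hre) (key _ him fun h' => h0 ?_)
      ext z
      exact Complex.ext (congrFun h z) (congrFun h' z)
    · exact add_lt_add_of_lt_of_le (key _ hre h) (key' _ him)
  refine ⟨hexc, ?_, ?_⟩
  · obtain ⟨E, hE, -⟩ := hlow
    obtain ⟨ψ, hψ, h0⟩ := mem_energies_iff.1 (groundEnergy_mem ⟨E, hE⟩)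
    have hge := energyForm_ge hn hH hη₀ htail hγ hb₀ hb
    have h1 := re_star_dotProduct_hamiltonian H η b ψ
    have h2 := re_star_dotProduct_self ψ
    rw [hψ, dotProduct_smul, smul_eq_mul, Complex.re_ofReal_mul] at h1
    refine le_of_mul_le_mul_right ?_ (re_star_dotProduct_self_pos h0)
    rw [h1, h2, mul_add]
    exact add_le_add (hge _) (hge _)
  · obtain ⟨E, hE, hE1⟩ := hlow
    exact (groundEnergy_le hE).trans hE1
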